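/- Let $\phi:[0,\infty)\to[0,\infty)$ be nondecreasing and right-continuous with $\phi(0)=0$, $\phi(t)>0$ for $t>0$, $\lim_{t\to\infty}\phi(t)=\infty$, and suppose that there is $a>1$ with $u\phi(u)<a\Phi(u)$ for all $u>0$, where $\Phi(u)=\int_0^u\phi(t)\,dt$ is the associated Young function. Let $\Omega\subset\mathbb{R}^n$ be open, and let $L_\Phi(\Omega)$ be the Orlicz space of (classes of) measurable functions $u:\Omega\to\mathbb{R}$ with $\int_\Omega\Phi(|u|)\,dx<\infty$, with the Luxemburg norm \[\|u\|_{\Phi,\Omega}=\inf\Big\{\lambda>0:\int_\Omega\Phi(|u(x)|/\lambda)\,dx\le 1\Big\}.\] Let $W^1_\Phi(\Omega)$ be the closure, in the norm $\|u\|^1_{\Phi,\Omega}=\max\{\|u\|_{\Phi,\Omega},\|\partial_1u\|_{\Phi,\Omega},\dots,\|\partial_nu\|_{\Phi,\Omega}\}$, of the set of those $u\in C^1(\bar\Omega)$ (that is, $u\in C^1(\Omega)$ such that $u$ and $Du$ extend continuously to $\bar\Omega$) for which this norm is defined, i.e. $u,\partial_iu\in L_\Phi(\Omega)$. Let $f:\Omega\times\mathbb{R}^n\to\mathbb{R}$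 be such that $f(x,\cdot)$ is continuous for almost every $x\in\Omega$, $f(\cdot,p)$ is measurable for every $p\in\mathbb{R}^n$, $f(x,\cdot)$ is convex for every $x\in\Omega$, and, for some constants $c^1_f,c^2_f>0$, \[c^1_f\,\Phi(|p|)\le f(x,p)\le c^2_f\,(1+\Phi(|p|))\qquad\text{for all }(x,p)\in\Omega\times\mathbb{R}^n .\] Put $F(u,\Omega)=\int_\Omega f(x,Du(x))\,dx\in[0,\infty]$ for $u\in W^1_\Phi(\Omega)$. Then $F(\cdot,\Omega)$ is lower semicontinuous in the weak topology of $W^1_\Phi(\Omega)$; in particular, if $u_k\to u$ weakly in $W^1_\Phi(\Omega)$, then \[F(u,\Omega)\le\liminf_{k\to\infty}F(u_k,\Omega).\] -/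

import Mathlib

open MeasureTheory Filter Topology Set
open scoped ENNReal

noncomputable section

/-- A Young function `Φ(u) = ∫₀ᵘ φ(t) dt` (`u ≥ 0`), given by its density `φ` on `[0, ∞)`. The values
of `φ` on the negative half-line play no role. -/
structure YoungFunction where
  /-- the density `φ` -/
  φ : ℝ → ℝ
  φ_zero : φ 0 = 0
  φ_pos : ∀ t, 0 < t → 0 < φ t
  φ_mono : MonotoneOn φ (Ici 0)
  φ_rightCont : ∀ t, 0 ≤ t → ContinuousWithinAt φ (Ici t) t
  φ_tendsto : Tendsto φ atTop atTop
  growth : ∃ a : ℝ, 1 < a ∧ ∀ u, 0 < u → u * φ u < a * ∫ t in (0 : ℝ)..u, φ t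

namespace YoungFunction

/-- `Φ(u) = ∫₀ᵘ φ(t) dt`. -/
def toFun (Φ : YoungFunction) (u : ℝ) : ℝ := ∫ t in (0 : ℝ)..u, Φ.φ t

instance : CoeFun YoungFunction (fun _ => ℝ → ℝ) := ⟨toFun⟩

variable (Φ : YoungFunction)

lemma intInt {a b : ℝ} (ha : 0 ≤ a) (hb : 0 ≤ b) : IntervalIntegrable Φ.φ volume a b := by
  apply MonotoneOn.intervalIntegrable
  apply Φ.φ_mono.mono
  intro x hx
  exact le_trans (le_min ha hb) hx.1

lemma φ_nonneg {t : ℝ} (ht : 0 ≤ t) : 0 ≤ Φ.φ t := by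
  have := Φ.φ_mono (mem_Ici.2 le_rfl) (mem_Ici.2 ht) ht
  rwa [Φ.φ_zero] at this

lemma zero : Φ 0 = 0 := by simp [toFun]

/-- Subgradient inequality. -/
lemma subgrad {a b : ℝ} (ha : 0 ≤ a) (hb : 0 ≤ b) : Φ a + Φ.φ a * (b - a) ≤ Φ b := by
  have h1 : Φ b - Φ a = ∫ t in a..b, Φ.φ t :=
    intervalIntegral.integral_interval_sub_left (Φ.intInt le_rfl hb) (Φ.intInt le_rfl ha)
  rcases le_total a b with hab | hab
  · have := intervalIntegral.integral_mono_on hab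
      (intervalIntegrable_const (c := Φ.φ a) (μ := volume)) (Φ.intInt ha hb)
      (fun x hx => Φ.φ_mono (mem_Ici.2 ha) (mem_Ici.2 (ha.trans hx.1)) hx.1)
    rw [intervalIntegral.integral_const, smul_eq_mul] at this
    linarith
  · have := intervalIntegral.integral_mono_on hab (Φ.intInt hb ha)
      (intervalIntegrable_const (c := Φ.φ a) (μ := volume))
      (fun x hx => Φ.φ_mono (mem_Ici.2 (hb.trans hx.1)) (mem_Ici.2 ha) hx.2)
    rw [intervalIntegral.integral_const, smul_eq_mul] at this
    rw [intervalIntegral.integral_symm] at h1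
    linarith

lemma mono {a b : ℝ} (ha : 0 ≤ a) (hab : a ≤ b) : Φ a ≤ Φ b := by
  have := Φ.subgrad ha (ha.trans hab)
  nlinarith [mul_nonneg (Φ.φ_nonneg ha) (sub_nonneg.2 hab)]

lemma nonneg {a : ℝ} (ha : 0 ≤ a) : 0 ≤ Φ a := by
  simpa [Φ.zero] using Φ.mono le_rfl ha

lemma pos {a : ℝ} (ha : 0 < a) : 0 < Φ a := by
  have h := Φ.subgrad (a := a / 2) (b := a) (by positivity) ha.le
  have h2 := Φ.φ_pos (a / 2) (by positivity)
  have h3 := Φ.nonneg (a := a / 2) (by positivity)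
  nlinarith [mul_pos h2 (show 0 < a - a / 2 by linarith)]

lemma convex {a b s t : ℝ} (ha : 0 ≤ a) (hb : 0 ≤ b) (hs : 0 ≤ s) (ht : 0 ≤ t) (hst : s + t = 1) :
    Φ (s * a + t * b) ≤ s * Φ a + t * Φ b := by
  have hc : 0 ≤ s * a + t * b := by positivity
  have h1 := mul_le_mul_of_nonneg_left (Φ.subgrad hc ha) hs
  have h2 := mul_le_mul_of_nonneg_left (Φ.subgrad hc hb) ht
  obtain rfl : t = 1 - s := by linarith
  linarith

lemma mul_le {a s : ℝ} (ha : 0 ≤ a) (hs : 0 ≤ s) (hs1 : s ≤ 1) : Φ (s * a) ≤ s * Φ a := by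
  have := Φ.convex ha le_rfl hs (sub_nonneg.2 hs1) (by ring)
  simpa [Φ.zero] using this

/-- The doubling property: every dilation is controlled. -/
lemma exists_dilation {r : ℝ} (hr : 0 ≤ r) : ∃ k : ℝ, 0 ≤ k ∧ ∀ u, 0 ≤ u → Φ (r * u) ≤ k * Φ u := by
  obtain ⟨a, ha, hgr⟩ := Φ.growth
  set l : ℝ := 2 * a / (2 * a - 1) with hl
  have hd : 0 < 2 * a - 1 := by linarith
  have hl1 : 1 < l := by rw [hl, lt_div_iff₀ hd]; linarith
  have hla : (l - 1) * (2 * a) = l := by rw [hl]; field_simp; ring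
  have step : ∀ u, 0 ≤ u → Φ (l * u) ≤ 2 * Φ u := by
    intro u hu
    rcases hu.eq_or_lt with rfl | hu
    · simp [Φ.zero]
    have hlu : 0 < l * u := by positivity
    have h1 := Φ.subgrad hlu.le hu.le
    have h2 : l * u * Φ.φ (l * u) < a * Φ (l * u) := hgr _ hlu
    have h3 : l * (u * Φ.φ (l * u)) < a * Φ (l * u) := by linarith
    have h4 : (l - 1) * (2 * a) * (u * Φ.φ (l * u)) < a * Φ (l * u) := by rw [hla]; exact h3
    have h5 : 2 * ((l - 1) * (u * Φ.φ (l * u))) < Φ (l * u) := by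
      by_contra hcon
      push Not at hcon
      nlinarith
    nlinarith
  have iter : ∀ m : ℕ, ∀ u, 0 ≤ u → Φ (l ^ m * u) ≤ 2 ^ m * Φ u := by
    intro m
    induction m with
    | zero => intro u _; simp
    | succ m ih =>
      intro u hu
      have e : l ^ (m + 1) * u = l * (l ^ m * u) := by ring
      rw [e]
      have := step (l ^ m * u) (by positivity)
      have := ih u hu
      rw [pow_succ]
      linarith
  obtain ⟨m, hm⟩ := pow_unbounded_of_one_lt |r| hl1
  refine ⟨2 ^ m, by positivity, fun u hu => ?_⟩
  rw [abs_of_nonneg hr] at hm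
  exact (Φ.mono (by positivity) (mul_le_mul_of_nonneg_right hm.le hu)).trans (iter m u hu)

end YoungFunction

section Orlicz

variable {α : Type*} [MeasurableSpace α]

/-- The modular `ρ(u, Φ) = ∫ Φ(|u|) dμ`, with values in `[0, ∞]`. -/
def orliczModular (Φ : YoungFunction) (μ : Measure α) (u : α → ℝ) : ℝ≥0∞ :=
  ∫⁻ x, ENNReal.ofReal (Φ |u x|) ∂μ

variable {Φ : YoungFunction} {μ : Measure α}

lemma orliczModular_congr {u v : α → ℝ} (h : u =ᵐ[μ] v) :
    orliczModular Φ μ u = orliczModular Φ μ v :=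
  lintegral_congr_ae (h.mono fun x hx => by simp only [hx])

lemma YoungFunction.measurable_abs (Φ : YoungFunction) : Measurable fun t : ℝ => Φ |t| := by
  have h : Measurable fun t : ℝ => Φ (max t 0) :=
    Monotone.measurable fun a b hab => Φ.mono (le_max_right _ _) (max_le_max_right 0 hab)
  have := h.comp (measurable_id.abs (α := ℝ))
  simpa [Function.comp_def] using this

lemma aemeas_modular {u : α → ℝ} (hu : AEMeasurable u μ) :
    AEMeasurable (fun x => ENNReal.ofReal (Φ |u x|)) μ :=
  (Φ.measurable_abs.comp_aemeasurable hu).ennreal_ofReal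

lemma orliczModular_const_mul_le {k c : ℝ} (hk : 0 ≤ k)
    (h : ∀ t, 0 ≤ t → Φ (|c| * t) ≤ k * Φ t) (u : α → ℝ) :
    orliczModular Φ μ (fun x => c * u x) ≤ ENNReal.ofReal k * orliczModular Φ μ u := by
  unfold orliczModular
  rw [← lintegral_const_mul' _ _ ENNReal.ofReal_ne_top]
  refine lintegral_mono fun x => ?_
  rw [← ENNReal.ofReal_mul hk, abs_mul]
  exact ENNReal.ofReal_le_ofReal (h _ (abs_nonneg _))

lemma orliczModular_convex {s t : ℝ} (hs : 0 ≤ s) (ht : 0 ≤ t) (hst : s + t = 1)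
    {u v : α → ℝ} (hu : AEMeasurable u μ) :
    orliczModular Φ μ (fun x => s * u x + t * v x) ≤
      ENNReal.ofReal s * orliczModular Φ μ u + ENNReal.ofReal t * orliczModular Φ μ v := by
  unfold orliczModular
  rw [← lintegral_const_mul' _ _ ENNReal.ofReal_ne_top,
    ← lintegral_const_mul' _ _ ENNReal.ofReal_ne_top,
    ← lintegral_add_left' ((aemeas_modular hu).const_mul _)]
  refine lintegral_mono fun x => ?_
  rw [← ENNReal.ofReal_mul hs, ← ENNReal.ofReal_mul ht, ← ENNReal.ofReal_add
    (mul_nonneg hs (Φ.nonneg (abs_nonneg _))) (mul_nonneg ht (Φ.nonneg (abs_nonneg _)))]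
  refine ENNReal.ofReal_le_ofReal (le_trans (Φ.mono (abs_nonneg _) ?_)
    (Φ.convex (abs_nonneg _) (abs_nonneg _) hs ht hst))
  calc |s * u x + t * v x| ≤ |s * u x| + |t * v x| := abs_add_le _ _
    _ = _ := by rw [abs_mul, abs_mul, abs_of_nonneg hs, abs_of_nonneg ht]

lemma orliczModular_const_mul_lt_top (c : ℝ) {u : α → ℝ} (hu : orliczModular Φ μ u < ∞) :
    orliczModular Φ μ (fun x => c * u x) < ∞ := by
  obtain ⟨k, hk, h⟩ := Φ.exists_dilation (abs_nonneg c)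
  exact (orliczModular_const_mul_le hk h u).trans_lt (ENNReal.mul_lt_top ENNReal.ofReal_lt_top hu)

/-- The Orlicz space `L_Φ(μ)`: the (classes of) measurable functions with `∫ Φ(|u|) dμ < ∞`. It is a
linear space because `Φ` is doubling. -/
def OrliczSpace (Φ : YoungFunction) (μ : Measure α) : Submodule ℝ (α →ₘ[μ] ℝ) where
  carrier := {u | orliczModular Φ μ u < ∞}
  zero_mem' := by
    change orliczModular Φ μ _ < ∞
    rw [orliczModular_congr (AEEqFun.coeFn_zero (μ := μ) (β := ℝ))]
    simp [orliczModular, Φ.zero]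
  add_mem' := by
    intro u v hu hv
    change orliczModular Φ μ _ < ∞
    have h2 := (orliczModular_convex (Φ := Φ) (μ := μ) (s := 1 / 2) (t := 1 / 2) (by norm_num)
      (by norm_num) (by norm_num) (u := fun x => 2 * u x) (v := fun x => 2 * v x)
      (u.aestronglyMeasurable.aemeasurable.const_mul 2))
    rw [orliczModular_congr (v := fun x => 1 / 2 * (2 * u x) + 1 / 2 * (2 * v x))]
    · exact h2.trans_lt (ENNReal.add_lt_top.2
        ⟨ENNReal.mul_lt_top ENNReal.ofReal_lt_top (orliczModular_const_mul_lt_top 2 hu),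
          ENNReal.mul_lt_top ENNReal.ofReal_lt_top (orliczModular_const_mul_lt_top 2 hv)⟩)
    · filter_upwards [AEEqFun.coeFn_add u v] with x hx
      rw [hx, Pi.add_apply]
      ring
  smul_mem' := by
    intro c u hu
    change orliczModular Φ μ _ < ∞
    rw [orliczModular_congr (AEEqFun.coeFn_smul c u)]
    exact orliczModular_const_mul_lt_top c hu

/-- The Luxemburg norm `inf {λ > 0 : ∫ Φ(|u|/λ) dμ ≤ 1}`. -/
def luxemburgNorm (Φ : YoungFunction) (μ : Measure α) (u : α → ℝ) : ℝ :=
  sInf {l : ℝ | 0 < l ∧ orliczModular Φ μ (fun x => u x / l) ≤ 1}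

lemma luxemburgNorm_congr {u v : α → ℝ} (h : u =ᵐ[μ] v) :
    luxemburgNorm Φ μ u = luxemburgNorm Φ μ v := by
  unfold luxemburgNorm
  congr 1
  ext l
  simp only [mem_ofPred_eq]
  rw [orliczModular_congr (v := fun x => v x / l) (h.mono fun x hx => by simp only [hx])]

lemma luxemburgNorm_nonneg (u : α → ℝ) : 0 ≤ luxemburgNorm Φ μ u :=
  Real.sInf_nonneg fun _ hl => hl.1.le

lemma luxemburg_bddBelow (u : α → ℝ) :
    BddBelow {l : ℝ | 0 < l ∧ orliczModular Φ μ (fun x => u x / l) ≤ 1} :=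
  ⟨0, fun _ hl => hl.1.le⟩

lemma luxemburg_nonempty {u : α → ℝ} (hu : orliczModular Φ μ u < ∞) :
    {l : ℝ | 0 < l ∧ orliczModular Φ μ (fun x => u x / l) ≤ 1}.Nonempty := by
  set r := (orliczModular Φ μ u).toReal with hr
  have hr0 : 0 ≤ r := ENNReal.toReal_nonneg
  have hl : 0 < r + 1 := by linarith
  have hi : 0 ≤ (r + 1)⁻¹ := by positivity
  have hi1 : (r + 1)⁻¹ ≤ 1 := inv_le_one_of_one_le₀ (by linarith)
  refine ⟨r + 1, hl, ?_⟩
  have h := orliczModular_const_mul_le (Φ := Φ) (μ := μ) (c := (r + 1)⁻¹) hi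
    (fun t ht => by rw [abs_of_nonneg hi]; exact Φ.mul_le ht hi hi1) u
  simp only [div_eq_inv_mul]
  refine h.trans ?_
  rw [← ENNReal.ofReal_toReal hu.ne, ← hr, ← ENNReal.ofReal_mul hi]
  refine ENNReal.ofReal_le_one.2 ?_
  rw [inv_mul_le_iff₀ hl]
  linarith

/-- Above the norm, the modular of the quotient is at most one. -/
lemma modular_div_le_one {u : α → ℝ} (hu : orliczModular Φ μ u < ∞) {l : ℝ}
    (hl : luxemburgNorm Φ μ u < l) : 0 < l ∧ orliczModular Φ μ (fun x => u x / l) ≤ 1 := by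
  obtain ⟨m, ⟨hm0, hm⟩, hml⟩ := exists_lt_of_csInf_lt (luxemburg_nonempty hu) hl
  have hl0 : 0 < l := hm0.trans hml
  refine ⟨hl0, le_trans (lintegral_mono fun x => ?_) hm⟩
  refine ENNReal.ofReal_le_ofReal (Φ.mono (abs_nonneg _) ?_)
  rw [abs_div, abs_div, abs_of_pos hl0, abs_of_pos hm0]
  exact div_le_div_of_nonneg_left (abs_nonneg _) hm0 hml.le

lemma luxemburgNorm_add_le {u v : α → ℝ} (hu : orliczModular Φ μ u < ∞)
    (hv : orliczModular Φ μ v < ∞) (hum : AEMeasurable u μ) :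
    luxemburgNorm Φ μ (fun x => u x + v x) ≤ luxemburgNorm Φ μ u + luxemburgNorm Φ μ v := by
  refine le_of_forall_pos_le_add fun ε hε => ?_
  obtain ⟨ha, ha'⟩ := modular_div_le_one hu (lt_add_of_pos_right _ (half_pos hε))
  obtain ⟨hb, hb'⟩ := modular_div_le_one hv (lt_add_of_pos_right _ (half_pos hε))
  set a := luxemburgNorm Φ μ u + ε / 2
  set b := luxemburgNorm Φ μ v + ε / 2
  have hab : 0 < a + b := by positivity
  have hst : a / (a + b) + b / (a + b) = 1 := by rw [← add_div, div_self hab.ne']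
  have h := orliczModular_convex (Φ := Φ) (μ := μ) (s := a / (a + b)) (t := b / (a + b))
    (by positivity) (by positivity) hst (u := fun x => u x / a) (v := fun x => v x / b)
    (hum.div_const a)
  have key : luxemburgNorm Φ μ (fun x => u x + v x) ≤ a + b := by
    refine csInf_le (luxemburg_bddBelow _) ⟨hab, ?_⟩
    have e : (fun x => (u x + v x) / (a + b)) =
        fun x => a / (a + b) * (u x / a) + b / (a + b) * (v x / b) := by
      ext x
      field_simp
    rw [e]
    refine h.trans ((add_le_add (mul_le_mul_right ha' _) (mul_le_mul_right hb' _)).trans ?_)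
    rw [mul_one, mul_one, ← ENNReal.ofReal_add (by positivity) (by positivity), hst,
      ENNReal.ofReal_one]
  simp only [a, b] at key
  linarith

lemma luxemburgNorm_zero : luxemburgNorm Φ μ (fun _ => 0) = 0 := by
  refine le_antisymm (le_of_forall_pos_le_add fun ε hε => ?_) (luxemburgNorm_nonneg _)
  rw [zero_add]
  refine csInf_le (luxemburg_bddBelow _) ⟨hε, ?_⟩
  simp [orliczModular, Φ.zero]

lemma luxemburgNorm_const_mul_le (c : ℝ) {u : α → ℝ} (hu : orliczModular Φ μ u < ∞) :
    luxemburgNorm Φ μ (fun x => c * u x) ≤ |c| * luxemburgNorm Φ μ u := by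
  rcases eq_or_ne c 0 with rfl | hc
  · simp [luxemburgNorm_zero]
  have hc' : 0 < |c| := abs_pos.2 hc
  refine le_of_forall_pos_le_add fun ε hε => ?_
  obtain ⟨ha, ha'⟩ := modular_div_le_one hu (lt_add_of_pos_right _ (div_pos hε hc'))
  set a := luxemburgNorm Φ μ u + ε / |c| with hadef
  have e : |c| * luxemburgNorm Φ μ u + ε = |c| * a := by rw [hadef]; field_simp
  rw [e]
  refine csInf_le (luxemburg_bddBelow _) ⟨mul_pos hc' ha, le_of_eq_of_le ?_ ha'⟩
  refine lintegral_congr fun x => ?_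
  congr 2
  rw [abs_div, abs_mul, abs_mul, abs_abs, abs_div, mul_div_mul_left _ _ hc'.ne']

lemma luxemburgNorm_const_mul (c : ℝ) {u : α → ℝ} (hu : orliczModular Φ μ u < ∞) :
    luxemburgNorm Φ μ (fun x => c * u x) = |c| * luxemburgNorm Φ μ u := by
  refine le_antisymm (luxemburgNorm_const_mul_le c hu) ?_
  rcases eq_or_ne c 0 with rfl | hc
  · simp [luxemburgNorm_zero]
  have hc' : 0 < |c| := abs_pos.2 hc
  have h := luxemburgNorm_const_mul_le c⁻¹ (orliczModular_const_mul_lt_top c hu)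
  have e : (fun x => c⁻¹ * (c * u x)) = u := by
    ext x
    field_simp
  rw [e, abs_inv] at h
  rwa [← le_inv_mul_iff₀ hc']

lemma ae_zero_of_luxemburgNorm_eq_zero {u : α → ℝ} (hum : AEMeasurable u μ)
    (hu : orliczModular Φ μ u < ∞) (h : luxemburgNorm Φ μ u = 0) : u =ᵐ[μ] fun _ => 0 := by
  have h0 : orliczModular Φ μ u = 0 := by
    refine le_antisymm (ENNReal.le_of_forall_pos_le_add fun ε hε _ => ?_) bot_le
    set d : ℝ := min ε 1
    have hd : 0 < d := lt_min (by exact_mod_cast hε) one_pos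
    have h1 := (modular_div_le_one hu (l := d) (by rw [h]; exact hd)).2
    have h2 := orliczModular_const_mul_le (Φ := Φ) (μ := μ) (c := d) hd.le
      (fun t ht => by rw [abs_of_pos hd]; exact Φ.mul_le ht hd.le (min_le_right _ _))
      (fun x => u x / d)
    have e : (fun x => d * (u x / d)) = u := by
      ext x
      field_simp
    rw [e] at h2
    rw [zero_add]
    calc orliczModular Φ μ u ≤ ENNReal.ofReal d * 1 := h2.trans (mul_le_mul_right h1 _)
      _ ≤ ε := by
        rw [mul_one]
        exact ENNReal.ofReal_le_of_le_toReal (min_le_left _ _)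
  have h3 := (lintegral_eq_zero_iff' (aemeas_modular (Φ := Φ) hum)).1 h0
  filter_upwards [h3] with x hx
  by_contra hne
  exact (ENNReal.ofReal_pos.2 (Φ.pos (abs_pos.2 hne))).ne' hx

instance : Norm (OrliczSpace Φ μ) := ⟨fun u => luxemburgNorm Φ μ u.1⟩

lemma orliczNormedSpaceCore : NormedSpace.Core ℝ (OrliczSpace Φ μ) where
  norm_nonneg u := luxemburgNorm_nonneg _
  norm_smul c u := by
    change luxemburgNorm Φ μ (c • u.1 : α →ₘ[μ] ℝ) = |c| * luxemburgNorm Φ μ u.1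
    rw [luxemburgNorm_congr (AEEqFun.coeFn_smul c u.1)]
    exact luxemburgNorm_const_mul c u.2
  norm_triangle u v := by
    change luxemburgNorm Φ μ (u.1 + v.1 : α →ₘ[μ] ℝ) ≤
      luxemburgNorm Φ μ u.1 + luxemburgNorm Φ μ v.1
    rw [luxemburgNorm_congr (AEEqFun.coeFn_add u.1 v.1)]
    exact luxemburgNorm_add_le u.2 v.2 u.1.aestronglyMeasurable.aemeasurable
  norm_eq_zero_iff u := by
    change luxemburgNorm Φ μ u.1 = 0 ↔ u = 0
    constructor
    · intro h
      apply Subtype.ext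
      apply AEEqFun.ext
      exact (ae_zero_of_luxemburgNorm_eq_zero u.1.aestronglyMeasurable.aemeasurable u.2 h).trans
        AEEqFun.coeFn_zero.symm
    · rintro rfl
      have : luxemburgNorm Φ μ ((0 : α →ₘ[μ] ℝ) : α → ℝ) = luxemburgNorm Φ μ (fun _ => 0) :=
        luxemburgNorm_congr AEEqFun.coeFn_zero
      exact this.trans luxemburgNorm_zero

instance : NormedAddCommGroup (OrliczSpace Φ μ) :=
  NormedAddCommGroup.ofCore (orliczNormedSpaceCore (Φ := Φ) (μ := μ))

instance : NormedSpace ℝ (OrliczSpace Φ μ) :=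
  NormedSpace.ofCore (orliczNormedSpaceCore (Φ := Φ) (μ := μ))

end Orlicz

section OrliczSobolev

variable {n : ℕ}

/-- `w ∈ C¹(Ω̄)`: `w` is `C¹` in the open set `Ω`, and `w` and `Dw` have continuous extensions to the
closure of `Ω`. -/
def IsC1Closure (Ω : Set (EuclideanSpace ℝ (Fin n))) (w : EuclideanSpace ℝ (Fin n) → ℝ) : Prop :=
  ContDiffOn ℝ 1 w Ω ∧
  (∃ w' : EuclideanSpace ℝ (Fin n) → ℝ, ContinuousOn w' (closure Ω) ∧ EqOn w w' Ω) ∧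
  ∃ g : EuclideanSpace ℝ (Fin n) → (EuclideanSpace ℝ (Fin n) →L[ℝ] ℝ),
    ContinuousOn g (closure Ω) ∧ EqOn (fderiv ℝ w) g Ω

/-- The partial derivative `∂w/∂xᵢ`. -/
def partialDeriv (i : Fin n) (w : EuclideanSpace ℝ (Fin n) → ℝ) (x : EuclideanSpace ℝ (Fin n)) :
    ℝ :=
  fderiv ℝ w x (EuclideanSpace.single i 1)

/-- The Orlicz space `L_Φ(Ω)` with respect to Lebesgue measure on `Ω`. -/
abbrev LPhi (Φ : YoungFunction) (Ω : Set (EuclideanSpace ℝ (Fin n))) : Type :=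
  OrliczSpace Φ ((volume : Measure (EuclideanSpace ℝ (Fin n))).restrict Ω)

/-- The space of all `(w, (∂₁w, …, ∂ₙw))` with `w ∈ C¹(Ω̄)`, where `w` and its first derivatives are in
`L_Φ(Ω)`. The norm of the ambient product is the maximum of the Luxemburg norms of the components,
so that here it is `max_{|β| ≤ 1} ‖D^β w‖_Φ`. -/
def c1Graph (Φ : YoungFunction) {Ω : Set (EuclideanSpace ℝ (Fin n))} (hΩ : IsOpen Ω) :
    Submodule ℝ (LPhi Φ Ω × (Fin n → LPhi Φ Ω)) where
  carrier := {p | ∃ w : EuclideanSpace ℝ (Fin n) → ℝ, IsC1Closure Ω w ∧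
    p.1.1 =ᵐ[volume.restrict Ω] w ∧ ∀ i, (p.2 i).1 =ᵐ[volume.restrict Ω] partialDeriv i w}
  zero_mem' := by
    refine ⟨fun _ => 0, ⟨contDiffOn_const, ⟨fun _ => 0, continuousOn_const, fun _ _ => rfl⟩,
      fun _ => 0, continuousOn_const, fun x _ => by simp⟩, AEEqFun.coeFn_zero, fun i => ?_⟩
    have : partialDeriv i (fun _ : EuclideanSpace ℝ (Fin n) => (0 : ℝ)) = 0 := by
      ext x
      simp [partialDeriv]
    rw [this]
    exact AEEqFun.coeFn_zero
  add_mem' := by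
    rintro p q ⟨w, ⟨hw, ⟨w', hw', ew⟩, g, hg, eg⟩, hp, hp'⟩
      ⟨v, ⟨hv, ⟨v', hv', ev⟩, k, hk, ek⟩, hq, hq'⟩
    have hd : ∀ x ∈ Ω, fderiv ℝ (fun y => w y + v y) x = fderiv ℝ w x + fderiv ℝ v x :=
      fun x hx => fderiv_fun_add
        ((hw.differentiableOn one_ne_zero).differentiableAt (hΩ.mem_nhds hx))
        ((hv.differentiableOn one_ne_zero).differentiableAt (hΩ.mem_nhds hx))
    refine ⟨fun x => w x + v x, ⟨hw.add hv, ⟨fun x => w' x + v' x, hw'.add hv',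
      fun x hx => by simp only [ew hx, ev hx]⟩, fun x => g x + k x, hg.add hk,
      fun x hx => by rw [hd x hx, eg hx, ek hx]⟩, ?_, fun i => ?_⟩
    · filter_upwards [AEEqFun.coeFn_add p.1.1 q.1.1, hp, hq] with x hx h1 h2
      rw [← h1, ← h2]
      exact hx
    · filter_upwards [AEEqFun.coeFn_add (p.2 i).1 (q.2 i).1, hp' i, hq' i,
        ae_restrict_mem hΩ.measurableSet] with x hx h1 h2 hxΩ
      refine hx.trans ?_
      rw [Pi.add_apply, h1, h2]
      simp [partialDeriv, hd x hxΩ]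
  smul_mem' := by
    rintro c p ⟨w, ⟨hw, ⟨w', hw', ew⟩, g, hg, eg⟩, hp, hp'⟩
    have hd : ∀ x ∈ Ω, fderiv ℝ (fun y => c • w y) x = c • fderiv ℝ w x :=
      fun x hx => fderiv_fun_const_smul
        ((hw.differentiableOn one_ne_zero).differentiableAt (hΩ.mem_nhds hx)) c
    refine ⟨fun x => c • w x, ⟨hw.const_smul c, ⟨fun x => c • w' x,
      hw'.const_smul c, fun x hx => by simp only [ew hx]⟩, fun x => c • g x,
      hg.const_smul c, fun x hx => by rw [hd x hx, eg hx]⟩, ?_, fun i => ?_⟩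
    · filter_upwards [AEEqFun.coeFn_smul c p.1.1, hp] with x hx h1
      rw [← h1]
      exact hx
    · filter_upwards [AEEqFun.coeFn_smul c (p.2 i).1, hp' i,
        ae_restrict_mem hΩ.measurableSet] with x hx h1 hxΩ
      refine hx.trans ?_
      rw [Pi.smul_apply, h1]
      change c • fderiv ℝ w x _ = fderiv ℝ (fun y => c • w y) x _
      rw [hd x hxΩ]
      rfl

/-- The Orlicz–Sobolev space `W¹_Φ(Ω)`: the closure of `C¹(Ω̄)` in the norm
`max_{|β| ≤ 1} ‖D^β u‖_Φ`. An element is recorded as a function together with its first partial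
derivatives, `(u, (∂₁u, …, ∂ₙu)) ∈ L_Φ(Ω) × L_Φ(Ω)ⁿ`, and the norm is the one of the product. -/
abbrev OrliczSobolev (Φ : YoungFunction) {Ω : Set (EuclideanSpace ℝ (Fin n))} (hΩ : IsOpen Ω) :
    Submodule ℝ (LPhi Φ Ω × (Fin n → LPhi Φ Ω)) :=
  (c1Graph Φ hΩ).topologicalClosure

variable {Φ : YoungFunction} {Ω : Set (EuclideanSpace ℝ (Fin n))} {hΩ : IsOpen Ω}

/-- The gradient `Du(x)` of an element of `W¹_Φ(Ω)`. -/
def OrliczSobolev.grad (u : OrliczSobolev Φ hΩ) (x : EuclideanSpace ℝ (Fin n)) :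
    EuclideanSpace ℝ (Fin n) :=
  WithLp.toLp 2 fun i => (u.1.2 i).1 x

/-- Convex Carathéodory integrands `f(x, p)` on `Ω × ℝⁿ` of `Φ`-growth,
`c₁ Φ(|p|) ≤ f(x, p) ≤ c₂ (1 + Φ(|p|))`. -/
structure IsConvexIntegrand (Φ : YoungFunction) (Ω : Set (EuclideanSpace ℝ (Fin n))) (c₁ c₂ : ℝ)
    (f : EuclideanSpace ℝ (Fin n) → EuclideanSpace ℝ (Fin n) → ℝ) : Prop where
  continuous : ∀ᵐ x ∂(volume.restrict Ω), Continuous (f x)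
  measurable : ∀ p, AEMeasurable (fun x => f x p) (volume.restrict Ω)
  convex : ∀ x ∈ Ω, ConvexOn ℝ univ (f x)
  lower : ∀ x ∈ Ω, ∀ p, c₁ * Φ ‖p‖ ≤ f x p
  upper : ∀ x ∈ Ω, ∀ p, f x p ≤ c₂ * (1 + Φ ‖p‖)

/-- `F(u, Ω) = ∫_Ω f(x, Du(x)) dx ∈ [0, ∞]`, for integrands `f ≥ 0`. -/
def energy (f : EuclideanSpace ℝ (Fin n) → EuclideanSpace ℝ (Fin n) → ℝ)
    (u : OrliczSobolev Φ hΩ) : ℝ≥0∞ :=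
  ∫⁻ x in Ω, ENNReal.ofReal (f x (OrliczSobolev.grad u x))

end OrliczSobolev

end

/-!
Norm convergence in `W¹_Φ(Ω)` forces convergence in measure of the gradients, so passing to an
almost everywhere convergent subsequence and applying Fatou's lemma shows that the energy is lower
semicontinuous for the norm topology. Its sublevel sets are therefore norm closed, and they are
convex because the integrand is; by Mazur's theorem they are weakly closed, which is weak lower
semicontinuity.
-/

open scoped NNReal

section Caratheodory

variable {α β γ : Type*} [MeasurableSpace α] {μ : Measure α} [MeasurableSpace γ]
  {f : α → β → γ}

lemma aemeasurable_comp_simpleFunc (hf : ∀ p, AEMeasurable (fun x => f x p) μ)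
    (s : SimpleFunc α β) : AEMeasurable (fun x => f x (s x)) μ := by
  refine ⟨fun x => (hf (s x)).mk _ x,
    s.measurable_bind (fun p x => (hf p).mk _ x) fun p => (hf p).measurable_mk, ?_⟩
  have h : ∀ᵐ x ∂μ, ∀ p ∈ s.range, f x p = (hf p).mk _ x :=
    (Finset.eventually_all s.range).2 fun p _ => (hf p).ae_eq_mk
  filter_upwards [h] with x hx
  exact hx _ (s.mem_range_self x)

lemma aemeasurable_comp_of_ae_continuous [PseudoEMetricSpace β] [SecondCountableTopology β]
    [MeasurableSpace β] [OpensMeasurableSpace β] [TopologicalSpace γ]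
    [TopologicalSpace.PseudoMetrizableSpace γ] [BorelSpace γ] {g : α → β}
    (hcont : ∀ᵐ x ∂μ, Continuous (f x)) (hmeas : ∀ p, AEMeasurable (fun x => f x p) μ)
    (hg : AEMeasurable g μ) : AEMeasurable (fun x => f x (g x)) μ := by
  rcases isEmpty_or_nonempty α with _ | ⟨⟨a⟩⟩
  · exact (measurable_of_empty _).aemeasurable
  let s (k : ℕ) : SimpleFunc α β :=
    SimpleFunc.approxOn (hg.mk g) hg.measurable_mk univ (g a) (mem_univ _) k
  refine aemeasurable_of_tendsto_metrizable_ae atTop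
    (fun k => aemeasurable_comp_simpleFunc hmeas (s k)) ?_
  filter_upwards [hcont, hg.ae_eq_mk] with x hx hgx
  rw [hgx]
  exact (hx.tendsto _).comp (SimpleFunc.tendsto_approxOn hg.measurable_mk (mem_univ _) (by simp))

end Caratheodory

section ConvergenceInMeasure

variable {α ι : Type*} [MeasurableSpace α] {μ : Measure α} {L : Filter ι}

lemma tendstoInMeasure_pi {κ : Type*} [Fintype κ] {E : κ → Type*} [∀ i, PseudoEMetricSpace (E i)]
    {f : ι → α → ∀ i, E i} {g : α → ∀ i, E i}
    (h : ∀ i, TendstoInMeasure μ (fun k x => f k x i) L fun x => g x i) :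
    TendstoInMeasure μ f L g := by
  intro ε hε
  have hsum : Tendsto (fun k => ∑ i, μ {x | ε ≤ edist (f k x i) (g x i)}) L (𝓝 0) := by
    simpa using tendsto_finsetSum Finset.univ fun i _ => h i ε hε
  refine tendsto_of_tendsto_of_tendsto_of_le_of_le tendsto_const_nhds hsum (fun _ => zero_le)
    fun k => (measure_mono fun x hx => ?_).trans (measure_iUnion_fintype_le μ _)
  have hsup : ε ≤ Finset.univ.sup fun i => edist (f k x i) (g x i) :=
    le_of_le_of_eq hx (edist_pi_def _ _)
  obtain ⟨i, -, hi⟩ := (Finset.le_sup_iff hε).1 hsup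
  exact mem_iUnion.2 ⟨i, hi⟩

lemma tendstoInMeasure_comp_of_uniformContinuous {E F : Type*} [PseudoEMetricSpace E]
    [PseudoEMetricSpace F] {T : E → F} (hT : UniformContinuous T) {f : ι → α → E} {g : α → E}
    (h : TendstoInMeasure μ f L g) :
    TendstoInMeasure μ (fun k x => T (f k x)) L fun x => T (g x) := by
  intro ε hε
  obtain ⟨δ, hδ, hTδ⟩ := EMetric.uniformContinuous_iff.1 hT ε hε
  refine tendsto_of_tendsto_of_tendsto_of_le_of_le tendsto_const_nhds (h δ hδ)
    (fun _ => zero_le) fun k => measure_mono fun x hx => ?_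
  exact le_of_not_gt fun hlt => (hTδ hlt).not_ge hx

lemma lintegral_comp_le_liminf_of_tendstoInMeasure {E : Type*} [PseudoEMetricSpace E]
    [NeBot L] [IsCountablyGenerated L] {f : α → E → ℝ≥0∞} {g : ι → α → E} {h : α → E}
    (hf : ∀ᵐ x ∂μ, LowerSemicontinuous (f x))
    (hmeas : ∀ k, AEMeasurable (fun x => f x (g k x)) μ) (hg : TendstoInMeasure μ g L h) :
    ∫⁻ x, f x (h x) ∂μ ≤ liminf (fun k => ∫⁻ x, f x (g k x) ∂μ) L := by
  obtain ⟨ns, hns, hlim⟩ := exists_seq_tendsto_liminf (f := L) (u := fun k => ∫⁻ x, f x (g k x) ∂μ)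
  obtain ⟨ms, hms, hae⟩ := (hg.comp hlim).exists_seq_tendsto_ae
  calc ∫⁻ x, f x (h x) ∂μ
      ≤ ∫⁻ x, liminf (fun j => f x (g (ns (ms j)) x)) atTop ∂μ := by
        refine lintegral_mono_ae ?_
        filter_upwards [hf, hae] with x hfx hx
        exact (hfx.le_liminf _).trans (liminf_le_liminf_of_le hx)
    _ ≤ liminf (fun j => ∫⁻ x, f x (g (ns (ms j)) x) ∂μ) atTop :=
        lintegral_liminf_le' fun j => hmeas _
    _ = liminf (fun k => ∫⁻ x, f x (g k x) ∂μ) L :=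
        (hns.comp hms.tendsto_atTop).liminf_eq

end ConvergenceInMeasure

section ConvexIntegral

lemma convexOn_ennreal_ofReal {E : Type*} [AddCommMonoid E] [Module ℝ E] {s : Set E} {g : E → ℝ}
    (hg : ConvexOn ℝ s g) : ConvexOn ℝ≥0 s fun p => ENNReal.ofReal (g p) := by
  refine ⟨hg.1.lift ℝ≥0, fun p hp q hq a b _ _ hab => ?_⟩
  calc ENNReal.ofReal (g (a • p + b • q))
      ≤ ENNReal.ofReal (a * g p + b * g q) :=
        ENNReal.ofReal_le_ofReal (hg.2 hp hq a.2 b.2 (by exact_mod_cast hab))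
    _ ≤ ENNReal.ofReal (a * g p) + ENNReal.ofReal (b * g q) := ENNReal.ofReal_add_le
    _ = a • ENNReal.ofReal (g p) + b • ENNReal.ofReal (g q) := by
        simp only [ENNReal.ofReal_mul NNReal.zero_le_coe, ENNReal.ofReal_coe_nnreal,
          ENNReal.smul_def, smul_eq_mul]

lemma convexOn_lintegral_comp {α V E : Type*} [MeasurableSpace α] {μ : Measure α}
    [AddCommMonoid V] [Module ℝ≥0 V] [AddCommMonoid E] [Module ℝ≥0 E]
    {f : α → E → ℝ≥0∞} {G : V → α → E}
    (hG : ∀ (a b : ℝ≥0) (u v : V), G (a • u + b • v) =ᵐ[μ] a • G u + b • G v)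
    (hf : ∀ᵐ x ∂μ, ConvexOn ℝ≥0 univ (f x))
    (hmeas : ∀ u, AEMeasurable (fun x => f x (G u x)) μ) :
    ConvexOn ℝ≥0 univ fun u => ∫⁻ x, f x (G u x) ∂μ := by
  refine ⟨convex_univ, fun u _ v _ a b _ _ hab => ?_⟩
  calc ∫⁻ x, f x (G (a • u + b • v) x) ∂μ
      ≤ ∫⁻ x, (a * f x (G u x) + b * f x (G v x)) ∂μ := by
        refine lintegral_mono_ae ?_
        filter_upwards [hG a b u v, hf] with x hx hfx
        rw [hx]
        exact hfx.2 (mem_univ _) (mem_univ _) zero_le zero_le hab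
    _ = a * ∫⁻ x, f x (G u x) ∂μ + b * ∫⁻ x, f x (G v x) ∂μ := by
        rw [lintegral_add_left' ((hmeas u).const_mul _),
          lintegral_const_mul' _ _ ENNReal.coe_ne_top, lintegral_const_mul' _ _ ENNReal.coe_ne_top]

end ConvexIntegral

lemma lowerSemicontinuous_comp_toWeakSpace_symm {V β : Type*} [AddCommGroup V] [Module ℝ V]
    [TopologicalSpace V] [IsTopologicalAddGroup V] [ContinuousSMul ℝ V] [LocallyConvexSpace ℝ V]
    [LinearOrder β] {F : V → β} (hconv : QuasiconvexOn ℝ univ F) (hF : LowerSemicontinuous F) :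
    LowerSemicontinuous fun w : WeakSpace ℝ V => F ((toWeakSpace ℝ V).symm w) := by
  refine lowerSemicontinuous_iff_isClosed_preimage.2 fun y => ?_
  have hsub : Convex ℝ (F ⁻¹' Iic y) := by simpa [preimage] using hconv y
  have h := hsub.toWeakSpace_closure ℝ
  rw [(hF.isClosed_preimage y).closure_eq, LinearEquiv.image_eq_preimage_symm] at h
  exact isClosed_of_closure_subset h.ge

section OrliczConvergence

variable {α ι : Type*} [MeasurableSpace α] {Φ : YoungFunction} {μ : Measure α} {L : Filter ι}

lemma ofReal_mul_meas_ge_le_orliczModular {u : α → ℝ} (hu : AEMeasurable u μ) {ε : ℝ}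
    (hε : 0 ≤ ε) : ENNReal.ofReal (Φ ε) * μ {x | ε ≤ |u x|} ≤ orliczModular Φ μ u :=
  (mul_le_mul_right (measure_mono fun _ hx => ENNReal.ofReal_le_ofReal (Φ.mono hε hx)) _).trans
    (mul_meas_ge_le_lintegral₀ (aemeas_modular hu) _)

lemma orliczModular_le_luxemburgNorm {u : α → ℝ} (hu : orliczModular Φ μ u < ∞)
    (hu1 : luxemburgNorm Φ μ u < 1) :
    orliczModular Φ μ u ≤ ENNReal.ofReal (luxemburgNorm Φ μ u) := by
  have hle : ∀ l ∈ Ioc (luxemburgNorm Φ μ u) 1, orliczModular Φ μ u ≤ ENNReal.ofReal l := by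
    rintro l ⟨hl, hl1⟩
    obtain ⟨hl0, hm⟩ := modular_div_le_one hu hl
    calc orliczModular Φ μ u
        = orliczModular Φ μ fun x => l * (u x / l) := by simp only [mul_div_cancel₀ _ hl0.ne']
      _ ≤ ENNReal.ofReal l * orliczModular Φ μ fun x => u x / l :=
          orliczModular_const_mul_le hl0.le
            (fun t ht => by simpa only [abs_of_pos hl0] using Φ.mul_le ht hl0.le hl1) _
      _ ≤ ENNReal.ofReal l := mul_le_of_le_one_right' hm
  exact ge_of_tendsto (ENNReal.continuous_ofReal.continuousWithinAt (s := Ioi _))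
    (mem_of_superset (Ioc_mem_nhdsGT hu1) hle)

lemma tendstoInMeasure_zero_of_tendsto_orliczModular {u : ι → α → ℝ}
    (hu : ∀ k, AEMeasurable (u k) μ) (h : Tendsto (fun k => orliczModular Φ μ (u k)) L (𝓝 0)) :
    TendstoInMeasure μ u L 0 := by
  refine tendstoInMeasure_iff_norm.2 fun ε hε => ?_
  have hΦ : ENNReal.ofReal (Φ ε) ≠ 0 := (ENNReal.ofReal_pos.2 (Φ.pos hε)).ne'
  have hlim : Tendsto (fun k => orliczModular Φ μ (u k) / ENNReal.ofReal (Φ ε)) L (𝓝 0) := by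
    simpa using ENNReal.Tendsto.div_const h (Or.inr hΦ)
  refine tendsto_of_tendsto_of_tendsto_of_le_of_le tendsto_const_nhds hlim (fun _ => zero_le)
    fun k => (ENNReal.le_div_iff_mul_le (Or.inl hΦ) (Or.inl ENNReal.ofReal_ne_top)).2 ?_
  simpa [mul_comm] using ofReal_mul_meas_ge_le_orliczModular (Φ := Φ) (hu k) hε.le

lemma OrliczSpace.tendsto_orliczModular_sub {u : ι → OrliczSpace Φ μ} {v : OrliczSpace Φ μ}
    (h : Tendsto u L (𝓝 v)) : Tendsto (fun k => orliczModular Φ μ (u k - v).1) L (𝓝 0) := by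
  have hnorm : Tendsto (fun k => ‖u k - v‖) L (𝓝 0) := tendsto_iff_norm_sub_tendsto_zero.1 h
  have hlim : Tendsto (fun k => ENNReal.ofReal ‖u k - v‖) L (𝓝 0) := by
    simpa using ENNReal.tendsto_ofReal hnorm
  refine tendsto_of_tendsto_of_tendsto_of_le_of_le' tendsto_const_nhds hlim
    (Eventually.of_forall fun _ => zero_le) ?_
  filter_upwards [hnorm.eventually_lt_const one_pos] with k hk
  exact orliczModular_le_luxemburgNorm (u k - v).2 hk

lemma OrliczSpace.tendstoInMeasure {u : ι → OrliczSpace Φ μ} {v : OrliczSpace Φ μ}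
    (h : Tendsto u L (𝓝 v)) : TendstoInMeasure μ (fun k => (u k).1) L v.1 := by
  have hsub : TendstoInMeasure μ (fun k => ⇑(u k).1 - ⇑v.1) L 0 :=
    (tendstoInMeasure_zero_of_tendsto_orliczModular
      (fun k => (u k - v).1.aestronglyMeasurable.aemeasurable)
      (OrliczSpace.tendsto_orliczModular_sub h)).congr_left
        fun k => AEEqFun.coeFn_sub (u k).1 v.1
  simpa [tendstoInMeasure_iff_norm] using hsub

end OrliczConvergence

section Gradient

variable {n : ℕ} {Φ : YoungFunction} {Ω : Set (EuclideanSpace ℝ (Fin n))} {hΩ : IsOpen Ω}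

lemma OrliczSobolev.aemeasurable_grad (u : OrliczSobolev Φ hΩ) :
    AEMeasurable (OrliczSobolev.grad u) (volume.restrict Ω) :=
  (WithLp.measurable_toLp 2 (Fin n → ℝ)).comp_aemeasurable
    (aemeasurable_pi_lambda _ fun i => (u.1.2 i).1.aestronglyMeasurable.aemeasurable)

lemma OrliczSobolev.grad_add_smul (a b : ℝ) (u v : OrliczSobolev Φ hΩ) :
    OrliczSobolev.grad (a • u + b • v) =ᵐ[volume.restrict Ω]
      a • OrliczSobolev.grad u + b • OrliczSobolev.grad v := by
  have h : ∀ i, ((a • u + b • v).1.2 i).1 =ᵐ[volume.restrict Ω]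
      a • ⇑(u.1.2 i).1 + b • ⇑(v.1.2 i).1 := fun i =>
    (AEEqFun.coeFn_add (a • (u.1.2 i).1) (b • (v.1.2 i).1)).trans
      ((AEEqFun.coeFn_smul a _).add (AEEqFun.coeFn_smul b _))
  filter_upwards [ae_all_iff.2 h] with x hx
  ext i
  exact hx i

lemma OrliczSobolev.tendstoInMeasure_grad {ι : Type*} {L : Filter ι} {u : ι → OrliczSobolev Φ hΩ}
    {v : OrliczSobolev Φ hΩ} (h : Tendsto u L (𝓝 v)) :
    TendstoInMeasure (volume.restrict Ω) (fun k => OrliczSobolev.grad (u k)) L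
      (OrliczSobolev.grad v) := by
  have hpartial : ∀ i, Tendsto (fun k => (u k).1.2 i) L (𝓝 (v.1.2 i)) :=
    tendsto_pi_nhds.1 ((continuous_snd.comp continuous_subtype_val).continuousAt.tendsto.comp h)
  exact tendstoInMeasure_comp_of_uniformContinuous
    (PiLp.lipschitzWith_toLp 2 fun _ : Fin n => ℝ).uniformContinuous
    (tendstoInMeasure_pi fun i => OrliczSpace.tendstoInMeasure (hpartial i))

end Gradient

section Energy

variable {n : ℕ} {Φ : YoungFunction} {Ω : Set (EuclideanSpace ℝ (Fin n))} {hΩ : IsOpen Ω}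
  {f : EuclideanSpace ℝ (Fin n) → EuclideanSpace ℝ (Fin n) → ℝ≥0∞}

lemma lowerSemicontinuous_lintegral_comp_grad
    (hf : ∀ᵐ x ∂(volume.restrict Ω), LowerSemicontinuous (f x))
    (hmeas : ∀ u : OrliczSobolev Φ hΩ,
      AEMeasurable (fun x => f x (OrliczSobolev.grad u x)) (volume.restrict Ω)) :
    LowerSemicontinuous fun u : OrliczSobolev Φ hΩ => ∫⁻ x in Ω, f x (OrliczSobolev.grad u x) :=
  lowerSemicontinuous_iff_le_liminf.2 fun _ => lintegral_comp_le_liminf_of_tendstoInMeasure hf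
    hmeas (OrliczSobolev.tendstoInMeasure_grad tendsto_id)

lemma quasiconvexOn_lintegral_comp_grad
    (hconv : ∀ᵐ x ∂(volume.restrict Ω), ConvexOn ℝ≥0 univ (f x))
    (hmeas : ∀ u : OrliczSobolev Φ hΩ,
      AEMeasurable (fun x => f x (OrliczSobolev.grad u x)) (volume.restrict Ω)) :
    QuasiconvexOn ℝ univ
      fun u : OrliczSobolev Φ hΩ => ∫⁻ x in Ω, f x (OrliczSobolev.grad u x) := fun y =>
  NNReal.convex_iff.1 <| (convexOn_lintegral_comp
    (fun a b u v => OrliczSobolev.grad_add_smul (a : ℝ) b u v) hconv hmeas).quasiconvexOn y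

end Energy

theorem proposition1_general {n : ℕ} (Φ : YoungFunction) {Ω : Set (EuclideanSpace ℝ (Fin n))}
    (hΩ : IsOpen Ω) {f : EuclideanSpace ℝ (Fin n) → EuclideanSpace ℝ (Fin n) → ℝ≥0∞}
    (hcont : ∀ᵐ x ∂(volume.restrict Ω), Continuous (f x))
    (hmeas : ∀ p, AEMeasurable (fun x => f x p) (volume.restrict Ω))
    (hconv : ∀ᵐ x ∂(volume.restrict Ω), ConvexOn ℝ≥0 univ (f x)) :
    LowerSemicontinuous (fun w : WeakSpace ℝ (OrliczSobolev Φ hΩ) =>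
      ∫⁻ x in Ω, f x (OrliczSobolev.grad ((toWeakSpace ℝ (OrliczSobolev Φ hΩ)).symm w) x)) ∧
    ∀ (u : ℕ → OrliczSobolev Φ hΩ) (u₀ : OrliczSobolev Φ hΩ),
      Tendsto (fun k => toWeakSpace ℝ (OrliczSobolev Φ hΩ) (u k)) atTop
        (𝓝 (toWeakSpace ℝ (OrliczSobolev Φ hΩ) u₀)) →
      ∫⁻ x in Ω, f x (OrliczSobolev.grad u₀ x) ≤
        liminf (fun k => ∫⁻ x in Ω, f x (OrliczSobolev.grad (u k) x)) atTop := by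
  have hcomp (u : OrliczSobolev Φ hΩ) :
      AEMeasurable (fun x => f x (OrliczSobolev.grad u x)) (volume.restrict Ω) :=
    aemeasurable_comp_of_ae_continuous hcont hmeas (OrliczSobolev.aemeasurable_grad u)
  have hlsc := lowerSemicontinuous_comp_toWeakSpace_symm
    (quasiconvexOn_lintegral_comp_grad hconv hcomp)
    (lowerSemicontinuous_lintegral_comp_grad (hcont.mono fun _ h => h.lowerSemicontinuous) hcomp)
  exact ⟨hlsc, fun _ u₀ hu => (hlsc.le_liminf (toWeakSpace ℝ _ u₀)).trans
    (liminf_le_liminf_of_le hu)⟩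

theorem proposition1 {n : ℕ} (Φ : YoungFunction) {Ω : Set (EuclideanSpace ℝ (Fin n))}
    (hΩ : IsOpen Ω) {c₁ c₂ : ℝ} (hc₁ : 0 < c₁) (hc₂ : 0 < c₂)
    (f : EuclideanSpace ℝ (Fin n) → EuclideanSpace ℝ (Fin n) → ℝ)
    (hf : IsConvexIntegrand Φ Ω c₁ c₂ f) :
    LowerSemicontinuous (fun w : WeakSpace ℝ (OrliczSobolev Φ hΩ) =>
        energy f ((toWeakSpace ℝ (OrliczSobolev Φ hΩ)).symm w)) ∧
    ∀ (u : ℕ → OrliczSobolev Φ hΩ) (u₀ : OrliczSobolev Φ hΩ),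
      Tendsto (fun k => toWeakSpace ℝ (OrliczSobolev Φ hΩ) (u k)) atTop
        (𝓝 (toWeakSpace ℝ (OrliczSobolev Φ hΩ) u₀)) →
      energy f u₀ ≤ liminf (fun k => energy f (u k)) atTop :=
  proposition1_general Φ hΩ (hf.continuous.mono fun _ h => ENNReal.continuous_ofReal.comp h)
    (fun p => (hf.measurable p).ennreal_ofReal)
    (ae_restrict_of_forall_mem hΩ.measurableSet fun x hx =>
      convexOn_ennreal_ofReal (hf.convex x hx))
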